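/- **Setting.** Let $x_{t+1}=Ax_t+Bu_t$ with $x_t\in\mathbb R^{n_x}$, $u_t\in\mathbb R^{n_u}$, let the columns of $G=(G_x,G_u)$ be a basis of the null space of $[A-I\ \ B]$, and put $x_v=G_xv$, $u_v=G_uv$ for $v\in\mathbb R^{n_v}$. Let $\mathcal V\subset\mathbb R^{n_v}$ be compact and convex. For $\tau\in\mathbb R$ let $\mathcal X^{\tau}=\{x: \acute b_x+\tau\vec 1\le Cx\le \grave b_x-\tau\vec 1\}$ and $\mathcal U^{\tau}=\{u:\acute b_u+\tau\vec 1\le Du\le\grave b_u-\tau\vec 1\}$, where $\acute b<\grave b$ elementwise. For $\theta=(x,v)$ and horizon $N\ge1$, let $\mathcal P^{\tau}(\theta)$ be the problem of minimizing $$\|x_N-x_v\|_P^2+\sum_{k=0}^{N-1}\big(\|x_k-x_v\|_Q^2+\|u_k-u_v\|_R^2\big)$$ over $\eta=(u_0,\dots,u_{N-1})$, where $x_0=x$, $x_{k+1}=Ax_k+Bu_k$, subject to $u_k\in\mathcal U^{\tau}$ $(0\le k<N)$ and $x_k\in\mathcal X^{\tau}$ $(1\le k\le N)$; equivalently, in condensed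 form with a slack variable $s$, over $y=(\eta,s)$ subject to $s=M\eta-L\theta$ and the tightened bounds on $s$, where $M\eta-L\theta$ stacks all $Du_k$ and $Cx_{k+1}$. Let $\Psi(\tau)$ be the set of $x$ for which $\mathcal P^\tau(x,v)$ is feasible (it does not depend on $v$), $V^\tau(\theta)$ the optimal value, $\psi^\tau=\sqrt{V^\tau}$, and $u^{*\tau}(\theta)$ the first control of the minimizer. **Assumptions.** (1) $\mathcal X^0\times\mathcal U^0$ is compact and contains the origin and all $(x_v,u_v)$, $v\in\mathcal V$, in its interior. (2) $(A,B)$ is stabilizable. (3) $P,Q,R\succ0$ and $P=Q+A^TPA-(A^TPB)K$ with $K=(R+B^TPB)^{-1}B^TPA$. (4) The Hessian of the condensed problem in $y=(\eta,s)$ is positive definite on the null space of $[M\ \ -I]$. **Constants.** Let $\beta_\chi>1$ and $\phi\ge0$ be Lipschitz constants in the sense that, for all $\tau,\tau'\ge0$ and all parameters with $v$-component in $\mathcal V$ at which the problems involved are feasible, $|\psi^{\tau}(\theta_a)-\psi^{\tau}(\theta_b)|\le\beta_\chi\|\theta_a-\theta_b\|$ and $\|u^{*\tau}(\theta)-u^{*\tau'}(\theta)\|\le\phi|\tau-\tau'|$.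 Let $0<\pi_1,\pi_2<1$. With $\overline\lambda$ the largest singular value and $H^\chi$ the block diagonal matrix with $N$ blocks $Q$, one block $P$ and $N$ blocks $R$, put $$\alpha_1=1-\sqrt{1-\lambda_{\min}(Q)/\beta_\chi^2},\qquad \zeta_1=\overline\lambda(B)\beta_\chi(\phi+1),$$ $$\alpha_2=1-\big(\pi_1+\pi_2\overline\lambda(B)(\phi+1)\big),\qquad \zeta_2=\pi_2\frac{\overline\lambda(A-I)+\overline\lambda(B)}{\sqrt{\lambda_{\min}(H^\chi)}},\qquad d=\frac{N\lambda_{\min}(Q)}{\lambda_{\max}(P)}+1,$$ and suppose $\alpha_2>0$. **Algorithm.** An iterative optimizer generates states $w_{j+1}=\mathcal T(\mathcal P^\tau(\theta),\{w_0,\dots,w_j\})$ from which a decision $\hat y=(\hat\eta,\hat s)$ with first control $\hat u$ is read off. For all $\tau\ge0$, $x\in\Psi(\tau)$, $v\in\mathcal V$ and every initial state $w_0$: $w_j$ converges to a state $w^*$ that corresponds to the minimizer; the residual $\mathsf r_j$ is such that $\mathsf r_j\le\tau$ implies that $\hat\eta$ satisfies the untightened constraints; and $\|\hat u-u^{*\tau}(\theta)\|^2\le\mathcal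 D^{\mathsf r}(\{w_0,\dots,w_j\})$ for every $j$. Fix $v\in\mathcal V$. At time $t$, given $x_t$, $\Sigma_t$ and the optimizer state returned at time $t-1$ as warm start (arbitrary at time $0$), the optimizer is applied to $\mathcal P^{\Sigma_t}(x_t,v)$ until $\mathcal D^{\mathsf r}(\{w_0,\dots,w_j\})\le\Sigma_t^2$ and $\mathsf r_j^2\le\Sigma_t^2$ (if this never happens, the limit $w^*$ is returned); with the resulting $\hat u$ one sets $x_{t+1}=Ax_t+B\hat u$ and $\Sigma_{t+1}=\pi_1\Sigma_t+\pi_2\|\theta_{t+1}-\theta_t\|$, where $\theta_t=(x_t,v)$. **Sets.** Let $p>0$ and $\check\Sigma_v,\check\psi_v\in\mathbb R$ be such that $\{x:\|x-x_v\|_P^2\le p\}\subseteq\{x: -K(x-x_v)+u_v\in\mathcal U^{\check\Sigma_v},\ x\in\mathcal X^{\check\Sigma_v}\}$, $\check\psi_v\le\sqrt{dp}$, and $$\check\Gamma^\Sigma(v)=\{x\in\Psi(0):\psi^0(x,v)\le\check\psi_v\}\subseteq\{x\in\Psi(\check\Sigma_v):\psi^{\check\Sigma_v}(x,v)\le\sqrt{dp}\}.$$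 Let $\check\Delta^\Sigma(v)=\{\Sigma: 0\le\Sigma\le\check\Sigma_v\}$. **Lemma.** If $(\zeta_2/\alpha_2)\check\psi_v\le\check\Sigma_v\le(\alpha_1/\zeta_1)\check\psi_v$ and $(x_0,\Sigma_0)\in\check\Gamma^\Sigma(v)\times\check\Delta^\Sigma(v)$, then for all $t\ge0$ the problem $\mathcal P^{\Sigma_t}(x_t,v)$ is feasible (recursive feasibility) and $(x_t,\Sigma_t)\in\check\Gamma^\Sigma(v)\times\check\Delta^\Sigma(v)$ (invariance). -/

import Mathlib

open Matrix Set Filter Topology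

noncomputable section

/-! ### Linear algebra conventions -/

/-- Euclidean norm of a real vector. -/
def eNorm {ι : Type*} [Fintype ι] (x : ι → ℝ) : ℝ :=
  ‖(WithLp.toLp 2 x : EuclideanSpace ℝ ι)‖

/-- Weighted square `‖a‖_E² = aᵀ E a`. -/
def wSq {ι : Type*} [Fintype ι] (E : Matrix ι ι ℝ) (a : ι → ℝ) : ℝ :=
  a ⬝ᵥ (E *ᵥ a)

/-- Smallest eigenvalue of a real symmetric matrix. -/
def lamMin {ι : Type*} [Fintype ι] [DecidableEq ι] (E : Matrix ι ι ℝ) : ℝ :=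
  sInf (spectrum ℝ E)

/-- Largest eigenvalue of a real symmetric matrix. -/
def lamMax {ι : Type*} [Fintype ι] [DecidableEq ι] (E : Matrix ι ι ℝ) : ℝ :=
  sSup (spectrum ℝ E)

/-- Largest singular value, i.e. the operator norm for the Euclidean norms. -/
def sigmaMax {m n : ℕ} (E : Matrix (Fin m) (Fin n) ℝ) : ℝ :=
  ‖(Matrix.toEuclideanLin E).toContinuousLinearMap‖

/-- The pair `(A, B)` is stabilizable: some linear state feedback makes all eigenvalues of the
closed-loop matrix lie in the open unit disc. -/
def IsStabilizable {nx nu : ℕ} (A : Matrix (Fin nx) (Fin nx) ℝ)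
    (B : Matrix (Fin nx) (Fin nu) ℝ) : Prop :=
  ∃ F : Matrix (Fin nu) (Fin nx) ℝ,
    ∀ z ∈ spectrum ℂ ((A - B * F).map (algebraMap ℝ ℂ)), ‖z‖ < 1

/-! ### The MPC problem -/

/-- The data of the tracking MPC problem with horizon `N`: the plant `x⁺ = A x + B u`, the
parametrisation `v ↦ (Gx v, Gu v)` of the equilibria, the constraints `bxLo ≤ C x ≤ bxHi` and
`buLo ≤ D u ≤ buHi`, the weights `P, Q, R` and the set `refs` of references. -/
structure MPCData (nx nu nv mx mu N : ℕ) where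
  A : Matrix (Fin nx) (Fin nx) ℝ
  B : Matrix (Fin nx) (Fin nu) ℝ
  Gx : Matrix (Fin nx) (Fin nv) ℝ
  Gu : Matrix (Fin nu) (Fin nv) ℝ
  C : Matrix (Fin mx) (Fin nx) ℝ
  D : Matrix (Fin mu) (Fin nu) ℝ
  bxLo : Fin mx → ℝ
  bxHi : Fin mx → ℝ
  buLo : Fin mu → ℝ
  buHi : Fin mu → ℝ
  P : Matrix (Fin nx) (Fin nx) ℝ
  Q : Matrix (Fin nx) (Fin nx) ℝ
  R : Matrix (Fin nu) (Fin nu) ℝ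
  refs : Set (Fin nv → ℝ)

namespace MPCData

variable {nx nu nv mx mu N : ℕ} (S : MPCData nx nu nv mx mu N)

/-- `G = (Gx, Gu)` is a basis (by columns) of the null space of `[A - I  B]`. -/
def IsEquilibriumBasis : Prop :=
  LinearIndependent ℝ (Matrix.fromRows S.Gx S.Gu).col ∧
    Submodule.span ℝ (Set.range (Matrix.fromRows S.Gx S.Gu).col) =
      LinearMap.ker (Matrix.fromCols (S.A - 1) S.B).mulVecLin

/-- Equilibrium state `x_v`. -/
def xEq (v : Fin nv → ℝ) : Fin nx → ℝ := S.Gx *ᵥ v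

/-- Equilibrium input `u_v`. -/
def uEq (v : Fin nv → ℝ) : Fin nu → ℝ := S.Gu *ᵥ v

/-- State constraint set tightened by `τ`; the nominal set is the case `τ = 0`. -/
def stateSet (τ : ℝ) : Set (Fin nx → ℝ) :=
  {x | ∀ i, S.bxLo i + τ ≤ (S.C *ᵥ x) i ∧ (S.C *ᵥ x) i ≤ S.bxHi i - τ}

/-- Input constraint set tightened by `τ`; the nominal set is the case `τ = 0`. -/
def inputSet (τ : ℝ) : Set (Fin nu → ℝ) :=
  {u | ∀ i, S.buLo i + τ ≤ (S.D *ᵥ u) i ∧ (S.D *ᵥ u) i ≤ S.buHi i - τ}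

/-- The predicted state at step `k` (only used for `k ≤ N`), from the initial state `x` under the
input sequence `η`. -/
def stateSeq (x : Fin nx → ℝ) (η : Fin N → Fin nu → ℝ) : ℕ → Fin nx → ℝ
  | 0 => x
  | k + 1 => if h : k < N then S.A *ᵥ stateSeq x η k + S.B *ᵥ η ⟨k, h⟩ else 0

/-- The tracking cost `‖x_N - x_v‖_P² + ∑_{k<N} (‖x_k - x_v‖_Q² + ‖u_k - u_v‖_R²)`. -/
def cost (x : Fin nx → ℝ) (v : Fin nv → ℝ) (η : Fin N → Fin nu → ℝ) : ℝ :=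
  wSq S.P (S.stateSeq x η N - S.xEq v) +
    ∑ k : Fin N, (wSq S.Q (S.stateSeq x η k - S.xEq v) + wSq S.R (η k - S.uEq v))

/-- Index set of the slack variable: the input rows for `u_0, …, u_{N-1}` and the state rows for
`x_1, …, x_N`. -/
abbrev Rows (mx mu N : ℕ) : Type := (Fin N × Fin mu) ⊕ (Fin N × Fin mx)

/-- The decision variable `y = (η, s)` of the condensed problem. -/
abbrev Decision (nu mx mu N : ℕ) : Type := (Fin N → Fin nu → ℝ) × (Rows mx mu N → ℝ)

/-- The stacked constraint outputs `M η - L θ`, i.e. all `D u_k` (`k < N`) and all `C x_k`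
(`1 ≤ k ≤ N`). In particular `M η` is the case `x = 0`. -/
def constr (x : Fin nx → ℝ) (η : Fin N → Fin nu → ℝ) : Rows mx mu N → ℝ :=
  Sum.elim (fun i => (S.D *ᵥ η i.1) i.2)
    (fun i => (S.C *ᵥ S.stateSeq x η ((i.1 : ℕ) + 1)) i.2)

/-- Stacked lower bounds. -/
def lo : Rows mx mu N → ℝ := Sum.elim (fun i => S.buLo i.2) (fun i => S.bxLo i.2)

/-- Stacked upper bounds. -/
def hi : Rows mx mu N → ℝ := Sum.elim (fun i => S.buHi i.2) (fun i => S.bxHi i.2)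

/-- Feasibility of `y = (η, s)` for the problem tightened by `τ`, at the state `x`:
`s = M η - L θ` and `lo + τ ≤ s ≤ hi - τ`. -/
def IsFeasible (τ : ℝ) (x : Fin nx → ℝ) (y : Decision nu mx mu N) : Prop :=
  y.2 = S.constr x y.1 ∧ ∀ i, S.lo i + τ ≤ y.2 i ∧ y.2 i ≤ S.hi i - τ

/-- The set `Ψ(τ)` of the states at which the problem tightened by `τ` is feasible. -/
def feasStates (τ : ℝ) : Set (Fin nx → ℝ) := {x | ∃ y, S.IsFeasible τ x y}

/-- `y` is a minimizer of the problem tightened by `τ`, with parameter `θ = (x, v)`. (The condensed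
objective differs from the tracking cost by a term that depends on `θ` only.) -/
def IsOptimal (τ : ℝ) (x : Fin nx → ℝ) (v : Fin nv → ℝ) (y : Decision nu mx mu N) : Prop :=
  S.IsFeasible τ x y ∧ ∀ y', S.IsFeasible τ x y' → S.cost x v y.1 ≤ S.cost x v y'.1

/-- Optimal value; only meaningful for `x ∈ Ψ(τ)`. -/
def value (τ : ℝ) (x : Fin nx → ℝ) (v : Fin nv → ℝ) : ℝ :=
  sInf {c | ∃ y, S.IsFeasible τ x y ∧ c = S.cost x v y.1}

/-- `ψ = √V`; only meaningful for `x ∈ Ψ(τ)`. -/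
def psi (τ : ℝ) (x : Fin nx → ℝ) (v : Fin nv → ℝ) : ℝ := Real.sqrt (S.value τ x v)

/-- First control of the minimizer; only meaningful for `x ∈ Ψ(τ)`. -/
def uStar [NeZero N] (τ : ℝ) (x : Fin nx → ℝ) (v : Fin nv → ℝ) : Fin nu → ℝ :=
  (Classical.epsilon (fun y => S.IsOptimal τ x v y)).1 0

/-- The Riccati gain `K = (R + Bᵀ P B)⁻¹ Bᵀ P A`. -/
def gain : Matrix (Fin nu) (Fin nx) ℝ :=
  (S.R + S.Bᵀ * S.P * S.B)⁻¹ * (S.Bᵀ * S.P * S.A)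

/-! ### Assumptions on the problem -/

/-- The reference set is compact and convex, and the bounds are strictly ordered. -/
def IsStandard : Prop :=
  IsCompact S.refs ∧ Convex ℝ S.refs ∧ (∀ i, S.bxLo i < S.bxHi i) ∧ (∀ i, S.buLo i < S.buHi i)

/-- The constraint set is compact and has the origin and all reference equilibria in its
interior. -/
def ConstraintAssumption : Prop :=
  IsCompact (S.stateSet 0 ×ˢ S.inputSet 0) ∧
    ((0 : Fin nx → ℝ), (0 : Fin nu → ℝ)) ∈ interior (S.stateSet 0 ×ˢ S.inputSet 0) ∧
    ∀ v ∈ S.refs, (S.xEq v, S.uEq v) ∈ interior (S.stateSet 0 ×ˢ S.inputSet 0)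

/-- The weights are positive definite and `P` solves the Riccati equation. -/
def WeightAssumption : Prop :=
  S.P.PosDef ∧ S.Q.PosDef ∧ S.R.PosDef ∧
    S.P = S.Q + S.Aᵀ * S.P * S.A - (S.Aᵀ * S.P * S.B) * S.gain

/-- The Hessian in `y = (η, s)` is positive definite on the null space of `[M  -I]`: the quadratic
part of the cost in `η` is `cost 0 0 η`, and `M η = constr 0 η`. -/
def HessianAssumption : Prop :=
  ∀ y : Decision nu mx mu N, y ≠ 0 → y.2 = S.constr 0 y.1 → 0 < S.cost 0 0 y.1

/-! ### Constants -/

/-- `β` is a Lipschitz constant of `ψ` in `θ = (x, v)`, for every tightening. -/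
def IsValueLipschitz (β : ℝ) : Prop :=
  ∀ τ, 0 ≤ τ → ∀ xa ∈ S.feasStates τ, ∀ xb ∈ S.feasStates τ, ∀ va ∈ S.refs, ∀ vb ∈ S.refs,
    |S.psi τ xa va - S.psi τ xb vb| ≤ β * eNorm (Sum.elim xa va - Sum.elim xb vb)

/-- `φ` is a Lipschitz constant of the first optimal control in the tightening. -/
def IsInputLipschitz [NeZero N] (φ : ℝ) : Prop :=
  ∀ τa τb, 0 ≤ τa → 0 ≤ τb → ∀ x ∈ S.feasStates τa, x ∈ S.feasStates τb → ∀ v ∈ S.refs,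
    eNorm (S.uStar τa x v - S.uStar τb x v) ≤ φ * |τa - τb|

/-- The block diagonal weight of the stacked sequence of states and controls. -/
def Hchi (S : MPCData nx nu nv mx mu N) :
    Matrix ((Fin nx × Fin N) ⊕ (Fin nx ⊕ (Fin nu × Fin N)))
      ((Fin nx × Fin N) ⊕ (Fin nx ⊕ (Fin nu × Fin N))) ℝ :=
  Matrix.fromBlocks (Matrix.blockDiagonal fun _ : Fin N => S.Q) 0 0
    (Matrix.fromBlocks S.P 0 0 (Matrix.blockDiagonal fun _ : Fin N => S.R))

/-- `d = N λ_min(Q) / λ_max(P) + 1`. -/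
def dConst (S : MPCData nx nu nv mx mu N) : ℝ := (N : ℝ) * lamMin S.Q / lamMax S.P + 1

def alpha1 (β : ℝ) : ℝ := 1 - Real.sqrt (1 - lamMin S.Q / β ^ 2)

def zeta1 (β φ : ℝ) : ℝ := sigmaMax S.B * β * (φ + 1)

def alpha2 (φ π1 π2 : ℝ) : ℝ := 1 - (π1 + π2 * sigmaMax S.B * (φ + 1))

def zeta2 (π2 : ℝ) : ℝ :=
  π2 * ((sigmaMax (S.A - 1) + sigmaMax S.B) / Real.sqrt (lamMin S.Hchi))

/-! ### Regions -/

/-- The sublevel set `{x | F(x - x_v) ≤ p}` of the terminal cost. -/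
def Omega (p : ℝ) (v : Fin nv → ℝ) : Set (Fin nx → ℝ) := {x | wSq S.P (x - S.xEq v) ≤ p}

/-- The states satisfying the constraints tightened by `τ`, together with the control given there
by the feedback `-K (x - x_v) + u_v`. -/
def feedbackSet (τ : ℝ) (v : Fin nv → ℝ) : Set (Fin nx → ℝ) :=
  {x | -(S.gain *ᵥ (x - S.xEq v)) + S.uEq v ∈ S.inputSet τ ∧ x ∈ S.stateSet τ}

/-- The estimate `Γ` of the region of attraction in the exact setting. -/
def Gam (τ p : ℝ) (v : Fin nv → ℝ) : Set (Fin nx → ℝ) :=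
  {x | x ∈ S.feasStates τ ∧ S.psi τ x v ≤ Real.sqrt (S.dConst * p)}

/-- The sublevel set `{x | ψ⁰(x, v) ≤ ψc}`. -/
def GamCheck (ψc : ℝ) (v : Fin nv → ℝ) : Set (Fin nx → ℝ) :=
  {x | x ∈ S.feasStates 0 ∧ S.psi 0 x v ≤ ψc}

end MPCData

/-- The admissible tightening parameters (which are nonnegative) up to `τc`. -/
def DelCheck (τc : ℝ) : Set ℝ := {τ | 0 ≤ τ ∧ τ ≤ τc}

/-! ### Inexact optimizer and closed loop -/

/-- An iterative optimizer with states in `W`. Every map but `Dr` may depend on the problem, that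
is, on the tightening `τ`, on `x` and on `v`; histories of optimizer states are lists with the
latest state first. -/
structure Optimizer (nx nu nv mx mu N : ℕ) (W : Type*) where
  /-- the update of the optimizer state, given the states so far -/
  update : ℝ → (Fin nx → ℝ) → (Fin nv → ℝ) → List W → W
  /-- the decision `ŷ = (η̂, ŝ)` read off from an optimizer state -/
  out : ℝ → (Fin nx → ℝ) → (Fin nv → ℝ) → W → MPCData.Decision nu mx mu N
  /-- the optimizer state that corresponds to the exact solution -/
  wStar : ℝ → (Fin nx → ℝ) → (Fin nv → ℝ) → W
  /-- the computable suboptimality bound used for termination -/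
  Dr : List W → ℝ
  /-- the primal residual -/
  res : ℝ → (Fin nx → ℝ) → (Fin nv → ℝ) → List W → ℝ

namespace Optimizer

variable {nx nu nv mx mu N : ℕ} {W : Type*} (O : Optimizer nx nu nv mx mu N W)

/-- Optimizer state after `j` iterations, together with the list of the earlier ones. -/
def run (τ : ℝ) (x : Fin nx → ℝ) (v : Fin nv → ℝ) (w0 : W) : ℕ → W × List W
  | 0 => (w0, [])
  | j + 1 => (O.update τ x v ((run τ x v w0 j).1 :: (run τ x v w0 j).2),
      (run τ x v w0 j).1 :: (run τ x v w0 j).2)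

/-- The iterate `w_j`. -/
def iter (τ : ℝ) (x : Fin nx → ℝ) (v : Fin nv → ℝ) (w0 : W) (j : ℕ) : W :=
  (O.run τ x v w0 j).1

/-- The history `w_j, …, w_0`. -/
def hist (τ : ℝ) (x : Fin nx → ℝ) (v : Fin nv → ℝ) (w0 : W) (j : ℕ) : List W :=
  (O.run τ x v w0 j).1 :: (O.run τ x v w0 j).2

/-- The class of optimizers considered: on every feasible problem and from every initial state
(i) the iterates converge to the state of the exact solution,
(ii) a residual at most `τ` guarantees that the untightened constraints hold,
(iii) `Dr` bounds the squared error of the first control. -/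
def IsAdmissible [NeZero N] [TopologicalSpace W] (S : MPCData nx nu nv mx mu N) : Prop :=
  ∀ τ, 0 ≤ τ → ∀ x ∈ S.feasStates τ, ∀ v ∈ S.refs, ∀ w0 : W,
    (S.IsOptimal τ x v (O.out τ x v (O.wStar τ x v)) ∧
      Tendsto (O.iter τ x v w0) atTop (𝓝 (O.wStar τ x v))) ∧
    (∀ j, O.res τ x v (O.hist τ x v w0 j) ≤ τ →
      ∀ i, S.lo i ≤ S.constr x (O.out τ x v (O.iter τ x v w0 j)).1 i ∧
        S.constr x (O.out τ x v (O.iter τ x v w0 j)).1 i ≤ S.hi i) ∧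
    (∀ j, eNorm ((O.out τ x v (O.iter τ x v w0 j)).1 0 - S.uStar τ x v) ^ 2 ≤
      O.Dr (O.hist τ x v w0 j))

/-- The termination test: both `Dr` and the squared residual are at most `τ²`. -/
def Stops (τ : ℝ) (x : Fin nx → ℝ) (v : Fin nv → ℝ) (w0 : W) (j : ℕ) : Prop :=
  O.Dr (O.hist τ x v w0 j) ≤ τ ^ 2 ∧ O.res τ x v (O.hist τ x v w0 j) ^ 2 ≤ τ ^ 2

open Classical in
/-- The optimizer state returned, from the warm start `w0`: the first iterate that passes the
termination test. If no iterate passes it (as may happen when `τ = 0`), the optimizer is run to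
convergence and the state of the exact solution is returned. -/
def final (τ : ℝ) (x : Fin nx → ℝ) (v : Fin nv → ℝ) (w0 : W) : W :=
  if h : ∃ j, O.Stops τ x v w0 j then O.iter τ x v w0 (Nat.find h) else O.wStar τ x v

end Optimizer

/-- State of the closed loop: plant state, tightening parameter, and warm start (the optimizer
state returned at the preceding instant). -/
structure LoopState (nx : ℕ) (W : Type*) where
  x : Fin nx → ℝ
  τ : ℝ
  w : W

/-- The update law `τ⁺ = π1 τ + π2 ‖θ⁺ - θ‖` of the tightening parameter, with `θ = (x, v)`. -/
def tightenUpdate {nx nv : ℕ} (π1 π2 : ℝ) (x' x : Fin nx → ℝ) (v' v : Fin nv → ℝ) (τ : ℝ) : ℝ :=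
  π1 * τ + π2 * eNorm (Sum.elim x' v' - Sum.elim x v)

/-- One time step of the plant in closed loop with the inexact MPC controller, for the constant
reference `v`. -/
def loopStep {nx nu nv mx mu N : ℕ} [NeZero N] {W : Type*} (S : MPCData nx nu nv mx mu N)
    (O : Optimizer nx nu nv mx mu N W) (π1 π2 : ℝ) (v : Fin nv → ℝ) (s : LoopState nx W) :
    LoopState nx W :=
  let w' := O.final s.τ s.x v s.w
  let x' := S.A *ᵥ s.x + S.B *ᵥ (O.out s.τ s.x v w').1 0
  { x := x', τ := tightenUpdate π1 π2 x' s.x v v s.τ, w := w' }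

/-- The closed-loop trajectory from `s`. -/
def loopTraj {nx nu nv mx mu N : ℕ} [NeZero N] {W : Type*} (S : MPCData nx nu nv mx mu N)
    (O : Optimizer nx nu nv mx mu N W) (π1 π2 : ℝ) (v : Fin nv → ℝ) (s : LoopState nx W)
    (t : ℕ) : LoopState nx W :=
  (loopStep S O π1 π2 v)^[t] s

end

noncomputable section

/-! ### Euclidean norms -/

section Norms

variable {ι κ : Type*} [Fintype ι] [Fintype κ]

/-! The proof compares one inexact closed-loop step with the step of the exact, untightened
controller and charges the difference to the tightening `τ`. Recursive feasibility then costs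
nothing: states of `GamCheck` are feasible at the largest admissible tightening `τc`, and
feasibility is monotone in the tightening.

Exact step. Below the cost level `d p` a minimizer ends in the terminal region `Omega`
(`terminal_mem_Omega`). Shifting it and appending the Riccati feedback lowers the value by at least
`λ_min(Q) ‖x - x_v‖²` (`value_succ_le`). Since `ψ` vanishes at `x_v`, its Lipschitz constant bounds
`ψ` by `β ‖x - x_v‖`, which turns this decrease into the contraction `ψ⁺ ≤ (1 - α₁) ψ`
(`psi_succ_le`).

Inexact step. The termination test costs an error `τ` in the control, and replacing the tightened
problem by the untightened one costs `φ τ`. The successor state is thus off by at most `σ(B) (φ + 1)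
τ`, so `ψ⁺ ≤ (1 - α₁) ψc + ζ₁ τ`, which is at most `ψc` by the upper bound on `τc`. The displacement
of the plant is at most this error plus a multiple of `ψ` (`eNorm_displacement_le`), so `τ⁺ ≤ (1 -
α₂) τ + ζ₂ ψ`, which is at most `τc` by the lower bound on `τc`.

The delicate point is feasibility of the perturbed successor, because `ψ` is Lipschitz only between
feasible states. One walks from the exact successor to the perturbed one in short steps. Each point
reached lies in the sublevel set, hence is feasible with tightening `τc > 0`, and this slack makes a
ball of fixed radius around it feasible (`mem_GamCheck_of_close`). -/

theorem eNorm_nonneg (x : ι → ℝ) : 0 ≤ eNorm x := norm_nonneg _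

theorem eNorm_eq_zero {x : ι → ℝ} : eNorm x = 0 ↔ x = 0 := by simp [eNorm]

theorem eNorm_zero : eNorm (0 : ι → ℝ) = 0 := eNorm_eq_zero.2 rfl

theorem eNorm_add_le (x y : ι → ℝ) : eNorm (x + y) ≤ eNorm x + eNorm y := by
  simpa [eNorm] using norm_add_le (WithLp.toLp 2 x) (WithLp.toLp 2 y)

theorem eNorm_smul (c : ℝ) (x : ι → ℝ) : eNorm (c • x) = |c| * eNorm x := by
  simp [eNorm, norm_smul]

theorem eNorm_sq (x : ι → ℝ) : eNorm x ^ 2 = x ⬝ᵥ x := by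
  rw [eNorm, EuclideanSpace.norm_sq_eq]
  simp [dotProduct, sq]

theorem abs_apply_le_eNorm (x : ι → ℝ) (i : ι) : |x i| ≤ eNorm x := by
  simpa [eNorm] using PiLp.norm_apply_le (WithLp.toLp 2 x : EuclideanSpace ℝ ι) i

theorem eNorm_sumElim_sub (x y : ι → ℝ) (z : κ → ℝ) :
    eNorm (Sum.elim x z - Sum.elim y z) = eNorm (x - y) := by
  simp [eNorm, EuclideanSpace.norm_eq]

theorem sigmaMax_nonneg {m n : ℕ} (E : Matrix (Fin m) (Fin n) ℝ) : 0 ≤ sigmaMax E :=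
  norm_nonneg _

theorem eNorm_mulVec_le {m n : ℕ} (E : Matrix (Fin m) (Fin n) ℝ) (x : Fin n → ℝ) :
    eNorm (E *ᵥ x) ≤ sigmaMax E * eNorm x := by
  simpa [eNorm, sigmaMax] using
    (Matrix.toEuclideanLin E).toContinuousLinearMap.le_opNorm (WithLp.toLp 2 x)

/-- A set that contains a ball of fixed radius around each of its points in a given ball contains
that ball as soon as it contains the centre. -/
theorem mem_of_uniform_thickening {F : Set (ι → ℝ)} {a b : ι → ℝ} {δ : ℝ} (hδ : 0 < δ)
    (ha : a ∈ F)
    (h : ∀ x ∈ F, eNorm (x - a) ≤ eNorm (b - a) → ∀ y, eNorm (y - x) ≤ δ → y ∈ F) : b ∈ F := by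
  -- Cutting the segment into `n` equal pieces makes each piece shorter than `δ`.
  obtain ⟨n, hn⟩ := exists_nat_gt (eNorm (b - a) / δ)
  have hn0 : (0 : ℝ) < n := lt_of_le_of_lt (div_nonneg (eNorm_nonneg _) hδ.le) hn
  have key : ∀ i : ℕ, i ≤ n → a + ((i : ℝ) / n) • (b - a) ∈ F := by
    intro i
    induction i with
    | zero => intro _; simpa using ha
    | succ i ih =>
      intro hi
      refine h _ (ih (by omega)) ?_ _ ?_
      · rw [add_sub_cancel_left, eNorm_smul, abs_of_nonneg (by positivity)]
        refine mul_le_of_le_one_left (eNorm_nonneg _) ?_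
        rw [div_le_one hn0]
        exact_mod_cast (by omega : i ≤ n)
      · have : a + (((i + 1 : ℕ) : ℝ) / n) • (b - a) - (a + ((i : ℝ) / n) • (b - a))
            = (1 / (n : ℝ)) • (b - a) := by
          rw [add_sub_add_left_eq_sub, ← sub_smul]
          congr 1
          push_cast
          ring
        rw [this, eNorm_smul, abs_of_nonneg (by positivity), one_div_mul_eq_div,
          div_le_iff₀ hn0, mul_comm]
        exact ((div_lt_iff₀ hδ).1 hn).le
  have := key n le_rfl
  rwa [div_self hn0.ne', one_smul, add_sub_cancel] at this

end Norms

/-! ### Quadratic forms -/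

section Quadratic

variable {ι κ : Type*} [Fintype ι] [Fintype κ]

theorem wSq_zero (E : Matrix ι ι ℝ) : wSq E 0 = 0 := by simp [wSq]

theorem wSq_neg (E : Matrix ι ι ℝ) (a : ι → ℝ) : wSq E (-a) = wSq E a := by
  simp [wSq, mulVec_neg]

theorem Matrix.PosDef.wSq_nonneg {E : Matrix ι ι ℝ} (hE : E.PosDef) (a : ι → ℝ) :
    0 ≤ wSq E a := by
  simpa [wSq] using hE.posSemidef.dotProduct_mulVec_nonneg a

theorem wSq_midpoint (E : Matrix ι ι ℝ) (a b : ι → ℝ) :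
    wSq E ((1 / 2 : ℝ) • a + (1 / 2 : ℝ) • b) =
      (wSq E a + wSq E b) / 2 - wSq E (a - b) / 4 := by
  simp only [wSq, mulVec_add, mulVec_sub, mulVec_smul, dotProduct_add, add_dotProduct,
    sub_dotProduct, dotProduct_sub, smul_dotProduct, dotProduct_smul, smul_eq_mul]
  ring

theorem wSq_fromBlocks_diagonal (E : Matrix ι ι ℝ) (F : Matrix κ κ ℝ) (a : ι ⊕ κ → ℝ) :
    wSq (Matrix.fromBlocks E 0 0 F) a = wSq E (a ∘ Sum.inl) + wSq F (a ∘ Sum.inr) := by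
  simp [wSq, fromBlocks_mulVec, dotProduct, Fintype.sum_sum_type]

theorem wSq_blockDiagonal [DecidableEq κ] (E : κ → Matrix ι ι ℝ) (a : ι × κ → ℝ) :
    wSq (Matrix.blockDiagonal E) a = ∑ k, wSq (E k) fun i => a (i, k) := by
  simp only [wSq, dotProduct, mulVec, Fintype.sum_prod_type, blockDiagonal_apply]
  rw [Finset.sum_comm]
  refine Finset.sum_congr rfl fun k _ => Finset.sum_congr rfl fun i _ => ?_
  congr 1
  refine Finset.sum_congr rfl fun j _ => ?_
  simp

theorem posDef_of_wSq_pos {E : Matrix ι ι ℝ} (hE : E.IsHermitian)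
    (h : ∀ a, a ≠ 0 → 0 < wSq E a) : E.PosDef :=
  PosDef.of_dotProduct_mulVec_pos hE fun a ha => by simpa [wSq] using h a ha

theorem Matrix.PosDef.wSq_pos {E : Matrix ι ι ℝ} (hE : E.PosDef) {a : ι → ℝ} (ha : a ≠ 0) :
    0 < wSq E a := by
  simpa [wSq] using hE.dotProduct_mulVec_pos ha

variable [DecidableEq ι]

/-- Subtracting `lamMin E` times the identity shifts the spectrum to the nonnegative half-line, so
the difference is positive semidefinite. -/
theorem Matrix.IsHermitian.lamMin_mul_le_wSq {E : Matrix ι ι ℝ} (hE : E.IsHermitian)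
    (a : ι → ℝ) : lamMin E * eNorm a ^ 2 ≤ wSq E a := by
  have hps : (E - algebraMap ℝ _ (lamMin E)).PosSemidef := by
    rw [posSemidef_iff_isHermitian_and_spectrum_nonneg]
    refine ⟨hE.sub (by simp [Algebra.algebraMap_eq_smul_one, IsHermitian]), fun z hz => ?_⟩
    have hz' : z + lamMin E ∈ spectrum ℝ E := by
      rw [spectrum.add_mem_iff, neg_add_eq_sub]
      exact hz
    have hb : BddBelow (spectrum ℝ E) := by
      rw [hE.spectrum_real_eq_range_eigenvalues]
      exact (Set.finite_range _).bddBelow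
    have := csInf_le hb hz'
    change 0 ≤ z
    change lamMin E ≤ _ at this
    linarith
  have := hps.dotProduct_mulVec_nonneg a
  simp [sub_mulVec, Algebra.algebraMap_eq_smul_one, smul_mulVec] at this
  rw [eNorm_sq]
  simpa [wSq] using this

/-- Needs neither symmetry nor boundedness, since the real `sInf` is by definition minus the `sSup`
of the negated set. It transfers the lower bound on quadratic forms to the upper bound. -/
theorem lamMin_neg (E : Matrix ι ι ℝ) : lamMin (-E) = -lamMax E := by
  rw [lamMin, lamMax, ← spectrum.neg_eq, Real.sInf_def, neg_neg]

theorem Matrix.IsHermitian.wSq_le_lamMax_mul {E : Matrix ι ι ℝ} (hE : E.IsHermitian)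
    (a : ι → ℝ) : wSq E a ≤ lamMax E * eNorm a ^ 2 := by
  have := hE.neg.lamMin_mul_le_wSq a
  rw [lamMin_neg] at this
  simp only [wSq, neg_mulVec, dotProduct_neg] at this ⊢
  linarith

theorem Matrix.PosDef.lamMin_pos [Nonempty ι] {E : Matrix ι ι ℝ} (hE : E.PosDef) :
    0 < lamMin E := by
  -- The infimum over a finite nonempty set is attained; for an empty index type it would be the
  -- default value `0`.
  obtain ⟨i, hi⟩ : lamMin E ∈ Set.range hE.isHermitian.eigenvalues := by
    rw [lamMin, hE.isHermitian.spectrum_real_eq_range_eigenvalues]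
    exact (Set.range_nonempty _).csInf_mem (Set.finite_range _)
  rw [← hi]
  exact hE.eigenvalues_pos i

theorem Matrix.PosDef.lamMax_pos [Nonempty ι] {E : Matrix ι ι ℝ} (hE : E.PosDef) :
    0 < lamMax E := by
  obtain ⟨i, hi⟩ : lamMax E ∈ Set.range hE.isHermitian.eigenvalues := by
    rw [lamMax, hE.isHermitian.spectrum_real_eq_range_eigenvalues]
    exact (Set.range_nonempty _).csSup_mem (Set.finite_range _)
  rw [← hi]
  exact hE.eigenvalues_pos i

end Quadratic

namespace MPCData

variable {nx nu nv mx mu N : ℕ} (S : MPCData nx nu nv mx mu N)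

/-! ### Trajectories -/

theorem stateSeq_succ (x : Fin nx → ℝ) (η : Fin N → Fin nu → ℝ) {k : ℕ} (hk : k < N) :
    S.stateSeq x η (k + 1) = S.A *ᵥ S.stateSeq x η k + S.B *ᵥ η ⟨k, hk⟩ := by
  simp [stateSeq, hk]

theorem stateSeq_linear (c d : ℝ) (x y : Fin nx → ℝ) (a b : Fin N → Fin nu → ℝ) :
    ∀ k, S.stateSeq (c • x + d • y) (c • a + d • b) k =
      c • S.stateSeq x a k + d • S.stateSeq y b k := by
  intro k
  induction k with
  | zero => rfl
  | succ k ih =>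
    by_cases hk : k < N
    · simp only [S.stateSeq_succ _ _ hk, ih, mulVec_add, mulVec_smul, smul_add, Pi.add_apply,
        Pi.smul_apply]
      abel
    · simp [stateSeq, hk]

theorem stateSeq_sub (x y : Fin nx → ℝ) (a b : Fin N → Fin nu → ℝ) (k : ℕ) :
    S.stateSeq (x - y) (a - b) k = S.stateSeq x a k - S.stateSeq y b k := by
  simpa [← sub_eq_add_neg] using S.stateSeq_linear 1 (-1) x y a b k

theorem stateSeq_zero_input (x : Fin nx → ℝ) {k : ℕ} (hk : k ≤ N) :
    S.stateSeq x 0 k = (S.A ^ k) *ᵥ x := by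
  induction k with
  | zero => simp [stateSeq]
  | succ k ih => simp [S.stateSeq_succ _ _ hk, ih (by omega), pow_succ']

/-- A pair of infinite state and input sequences that obeys the plant dynamics. -/
def IsTrajectory (X : ℕ → Fin nx → ℝ) (U : ℕ → Fin nu → ℝ) : Prop :=
  ∀ k, X (k + 1) = S.A *ᵥ X k + S.B *ᵥ U k

variable {S} in
-- Agreement of the inputs before step `n` suffices, so sequences can be spliced at `n`. Infinite
-- trajectories make splicing and shifting free of `Fin` arithmetic.
theorem IsTrajectory.stateSeq_eq {X : ℕ → Fin nx → ℝ} {U : ℕ → Fin nu → ℝ}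
    (h : S.IsTrajectory X U) {η : Fin N → Fin nu → ℝ} {n : ℕ}
    (hη : ∀ k : Fin N, (k : ℕ) < n → η k = U k) {k : ℕ} (hn : k ≤ n) (hk : k ≤ N) :
    S.stateSeq (X 0) η k = X k := by
  induction k with
  | zero => rfl
  | succ k ih =>
    rw [S.stateSeq_succ _ _ hk, ih (by omega) (by omega), h k, hη ⟨k, hk⟩ hn]

/-- The stage cost. -/
def stage (v : Fin nv → ℝ) (x : Fin nx → ℝ) (u : Fin nu → ℝ) : ℝ :=
  wSq S.Q (x - S.xEq v) + wSq S.R (u - S.uEq v)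

variable {S} in
theorem IsTrajectory.cost_eq {X : ℕ → Fin nx → ℝ} {U : ℕ → Fin nu → ℝ}
    (h : S.IsTrajectory X U) (v : Fin nv → ℝ) :
    S.cost (X 0) v (fun k : Fin N => U k) =
      wSq S.P (X N - S.xEq v) + ∑ k ∈ Finset.range N, S.stage v (X k) (U k) := by
  have hX : ∀ k, k ≤ N → S.stateSeq (X 0) (fun k : Fin N => U k) k = X k := fun k hk =>
    h.stateSeq_eq (n := N) (fun _ _ => rfl) hk hk
  rw [cost, hX N le_rfl, Finset.sum_range]
  congr 1
  exact Finset.sum_congr rfl fun k _ => by rw [hX k k.2.le, stage]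

theorem isFeasible_iff {τ : ℝ} {x : Fin nx → ℝ} {y : Decision nu mx mu N} :
    S.IsFeasible τ x y ↔ y.2 = S.constr x y.1 ∧
      ∀ k : Fin N, y.1 k ∈ S.inputSet τ ∧ S.stateSeq x y.1 (k + 1) ∈ S.stateSet τ := by
  refine and_congr_right fun h => ?_
  rw [h]
  constructor
  · exact fun H k => ⟨fun i => H (Sum.inl (k, i)), fun i => H (Sum.inr (k, i))⟩
  · rintro H (⟨k, i⟩ | ⟨k, i⟩)
    · exact (H k).1 i
    · exact (H k).2 i

variable {S} in
theorem IsTrajectory.isFeasible {X : ℕ → Fin nx → ℝ} {U : ℕ → Fin nu → ℝ}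
    (h : S.IsTrajectory X U) {τ : ℝ}
    (hXU : ∀ k < N, U k ∈ S.inputSet τ ∧ X (k + 1) ∈ S.stateSet τ) :
    S.IsFeasible τ (X 0) (fun k : Fin N => U k, S.constr (X 0) fun k : Fin N => U k) := by
  rw [isFeasible_iff]
  refine ⟨rfl, fun k => ⟨(hXU k k.2).1, ?_⟩⟩
  rw [h.stateSeq_eq (n := N) (fun _ _ => rfl) k.2 k.2]
  exact (hXU k k.2).2

/-- The feedback `-K (x - x_v) + u_v`. -/
def feedback (v : Fin nv → ℝ) (x : Fin nx → ℝ) : Fin nu → ℝ :=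
  -(S.gain *ᵥ (x - S.xEq v)) + S.uEq v

/-- Every input sequence can be continued by the feedback from any step on. -/
theorem exists_trajectory_feedback (v : Fin nv → ℝ) (x : Fin nx → ℝ) (η : Fin N → Fin nu → ℝ)
    {n : ℕ} (hn : n ≤ N) :
    ∃ X U, S.IsTrajectory X U ∧ X 0 = x ∧ (∀ k : Fin N, (k : ℕ) < n → U k = η k) ∧
      (∀ k, n ≤ k → U k = S.feedback v (X k)) ∧ (∀ k, k ≤ n → X k = S.stateSeq x η k) := by
  let κ : ℕ → (Fin nx → ℝ) → Fin nu → ℝ := fun k z =>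
    if h : k < n then η ⟨k, h.trans_le hn⟩ else S.feedback v z
  let X : ℕ → Fin nx → ℝ := fun k => Nat.rec x (fun k z => S.A *ᵥ z + S.B *ᵥ κ k z) k
  have hT : S.IsTrajectory X fun k => κ k (X k) := fun k => rfl
  have hU : ∀ k : Fin N, (k : ℕ) < n → κ k (X k) = η k := fun k hk => by simp [κ, hk]
  refine ⟨X, _, hT, rfl, hU, fun k hk => by simp [κ, hk.not_gt], fun k hk => ?_⟩
  exact (hT.stateSeq_eq (fun k hk => (hU k hk).symm) hk (hk.trans hn)).symm

/-! ### Monotonicity and robustness of feasibility -/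

theorem stateSet_anti {τ τ' : ℝ} (h : τ ≤ τ') : S.stateSet τ' ⊆ S.stateSet τ :=
  fun _ hx i => ⟨by linarith [(hx i).1], by linarith [(hx i).2]⟩

theorem inputSet_anti {τ τ' : ℝ} (h : τ ≤ τ') : S.inputSet τ' ⊆ S.inputSet τ :=
  fun _ hx i => ⟨by linarith [(hx i).1], by linarith [(hx i).2]⟩

theorem feasStates_anti {τ τ' : ℝ} (h : τ ≤ τ') : S.feasStates τ' ⊆ S.feasStates τ :=
  fun _ ⟨y, hy⟩ => ⟨y, hy.1, fun i => ⟨by linarith [(hy.2 i).1], by linarith [(hy.2 i).2]⟩⟩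

/-- Keep the input sequence and move only the initial state: the outputs change by `C A^(k+1) (x' -
x)`, and the tightening absorbs a change of at most `τ`. -/
theorem exists_thickening_feasStates {τ : ℝ} (hτ : 0 < τ) :
    ∃ δ > 0, ∀ x ∈ S.feasStates τ, ∀ x', eNorm (x' - x) ≤ δ → x' ∈ S.feasStates 0 := by
  -- The sum dominates every single norm, and the summand `1` keeps the divisor positive.
  set c : ℝ := 1 + ∑ k : Fin N, sigmaMax (S.C * S.A ^ ((k : ℕ) + 1)) with hc
  have hc0 : 0 < c := add_pos_of_pos_of_nonneg one_pos
    (Finset.sum_nonneg fun _ _ => sigmaMax_nonneg _)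
  refine ⟨τ / c, by positivity, ?_⟩
  rintro x ⟨y, hy⟩ x' hx'
  rw [isFeasible_iff] at hy
  refine ⟨(y.1, S.constr x' y.1), S.isFeasible_iff.2 ⟨rfl, fun k => ⟨?_, fun i => ?_⟩⟩⟩
  · exact S.inputSet_anti hτ.le (hy.2 k).1
  · have h1 := (hy.2 k).2 i
    have h2 : S.C *ᵥ S.stateSeq x' y.1 (k + 1) - S.C *ᵥ S.stateSeq x y.1 (k + 1) =
        (S.C * S.A ^ ((k : ℕ) + 1)) *ᵥ (x' - x) := by
      rw [← mulVec_sub, ← S.stateSeq_sub, sub_self, S.stateSeq_zero_input _ k.2, mulVec_mulVec]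
    have h3 : |(S.C *ᵥ S.stateSeq x' y.1 (k + 1) - S.C *ᵥ S.stateSeq x y.1 (k + 1)) i| ≤ τ := by
      rw [h2]
      refine (abs_apply_le_eNorm _ _).trans ((eNorm_mulVec_le _ _).trans ?_)
      have h4 : sigmaMax (S.C * S.A ^ ((k : ℕ) + 1)) ≤ c := by
        have := Finset.single_le_sum (f := fun k : Fin N => sigmaMax (S.C * S.A ^ ((k : ℕ) + 1)))
          (fun _ _ => sigmaMax_nonneg _) (Finset.mem_univ k)
        linarith
      calc _ ≤ c * (τ / c) := mul_le_mul h4 hx' (eNorm_nonneg _) hc0.le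
        _ = τ := by field_simp
    rw [Pi.sub_apply, abs_le] at h3
    constructor <;> linarith [h3.1, h3.2, h1.1, h1.2]

/-! ### Optimal value and uniqueness of the minimizer -/

variable {S}

theorem WeightAssumption.stage_nonneg (h3 : S.WeightAssumption) (v : Fin nv → ℝ)
    (x : Fin nx → ℝ) (u : Fin nu → ℝ) : 0 ≤ S.stage v x u :=
  add_nonneg (h3.2.1.wSq_nonneg _) (h3.2.2.1.wSq_nonneg _)

theorem WeightAssumption.cost_nonneg (h3 : S.WeightAssumption) (x : Fin nx → ℝ)
    (v : Fin nv → ℝ) (η : Fin N → Fin nu → ℝ) : 0 ≤ S.cost x v η :=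
  add_nonneg (h3.1.wSq_nonneg _) (Finset.sum_nonneg fun _ _ => h3.stage_nonneg _ _ _)

theorem IsOptimal.value_eq {τ : ℝ} {x : Fin nx → ℝ} {v : Fin nv → ℝ}
    {y : Decision nu mx mu N} (hy : S.IsOptimal τ x v y) : S.value τ x v = S.cost x v y.1 := by
  refine IsLeast.csInf_eq ⟨⟨y, hy.1, rfl⟩, ?_⟩
  rintro _ ⟨y', hy', rfl⟩
  exact hy.2 y' hy'

theorem WeightAssumption.value_nonneg (h3 : S.WeightAssumption) (τ : ℝ) (x : Fin nx → ℝ)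
    (v : Fin nv → ℝ) : 0 ≤ S.value τ x v := by
  -- No feasibility is needed, since the infimum of the empty set is `0`.
  refine Real.sInf_nonneg ?_
  rintro _ ⟨y, -, rfl⟩
  exact h3.cost_nonneg _ _ _

theorem WeightAssumption.value_le (h3 : S.WeightAssumption) {τ : ℝ} {x : Fin nx → ℝ}
    (v : Fin nv → ℝ) {y : Decision nu mx mu N} (hy : S.IsFeasible τ x y) :
    S.value τ x v ≤ S.cost x v y.1 := by
  refine csInf_le ⟨0, ?_⟩ ⟨y, hy, rfl⟩
  rintro _ ⟨y, -, rfl⟩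
  exact h3.cost_nonneg _ _ _

variable (S)

/-- The parallelogram identity: the cost is quadratic in the inputs, and its pure quadratic part is
`cost 0 0`. -/
theorem cost_midpoint (x : Fin nx → ℝ) (v : Fin nv → ℝ) (a b : Fin N → Fin nu → ℝ) :
    S.cost x v ((1 / 2 : ℝ) • a + (1 / 2 : ℝ) • b) =
      (S.cost x v a + S.cost x v b) / 2 - S.cost 0 0 (a - b) / 4 := by
  have hs : ∀ k, S.stateSeq x ((1 / 2 : ℝ) • a + (1 / 2 : ℝ) • b) k - S.xEq v =
      (1 / 2 : ℝ) • (S.stateSeq x a k - S.xEq v) + (1 / 2 : ℝ) • (S.stateSeq x b k - S.xEq v) := by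
    intro k
    have := S.stateSeq_linear (1 / 2) (1 / 2) x x a b k
    have hx : (1 / 2 : ℝ) • x + (1 / 2 : ℝ) • x = x := by module
    rw [hx] at this
    rw [this]
    module
  have hd : ∀ k, S.stateSeq x a k - S.xEq v - (S.stateSeq x b k - S.xEq v) =
      S.stateSeq 0 (a - b) k - S.xEq 0 := by
    intro k
    rw [sub_sub_sub_cancel_right, ← S.stateSeq_sub, sub_self]
    simp [xEq]
  have hu : ∀ k, ((1 / 2 : ℝ) • a + (1 / 2 : ℝ) • b) k - S.uEq v =
      (1 / 2 : ℝ) • (a k - S.uEq v) + (1 / 2 : ℝ) • (b k - S.uEq v) := by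
    intro k
    simp only [Pi.add_apply, Pi.smul_apply]
    module
  have hdu : ∀ k, a k - S.uEq v - (b k - S.uEq v) = (a - b) k - S.uEq 0 := by
    intro k
    simp [uEq]
  simp only [cost, hs, hu, wSq_midpoint, hd, hdu]
  have : ∀ k : Fin N, (wSq S.Q (S.stateSeq x a k - S.xEq v) + wSq S.Q (S.stateSeq x b k - S.xEq v)) / 2 -
        wSq S.Q (S.stateSeq 0 (a - b) k - S.xEq 0) / 4 +
      ((wSq S.R (a k - S.uEq v) + wSq S.R (b k - S.uEq v)) / 2 -
        wSq S.R ((a - b) k - S.uEq 0) / 4) =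
      (1 / 2) * (wSq S.Q (S.stateSeq x a k - S.xEq v) + wSq S.R (a k - S.uEq v)) +
      (1 / 2) * (wSq S.Q (S.stateSeq x b k - S.xEq v) + wSq S.R (b k - S.uEq v)) -
      (1 / 4) * (wSq S.Q (S.stateSeq 0 (a - b) k - S.xEq 0) + wSq S.R ((a - b) k - S.uEq 0)) :=
    fun k => by ring
  simp only [this, Finset.sum_add_distrib, Finset.sum_sub_distrib, ← Finset.mul_sum]
  ring

variable {S}

theorem IsFeasible.midpoint {τ : ℝ} {x : Fin nx → ℝ} {y z : Decision nu mx mu N}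
    (hy : S.IsFeasible τ x y) (hz : S.IsFeasible τ x z) :
    S.IsFeasible τ x ((1 / 2 : ℝ) • y.1 + (1 / 2 : ℝ) • z.1,
      S.constr x ((1 / 2 : ℝ) • y.1 + (1 / 2 : ℝ) • z.1)) := by
  rw [isFeasible_iff] at *
  refine ⟨rfl, fun k => ⟨fun i => ?_, fun i => ?_⟩⟩
  · have h1 := (hy.2 k).1 i
    have h2 := (hz.2 k).1 i
    simp only [Pi.add_apply, Pi.smul_apply, mulVec_add, mulVec_smul, smul_eq_mul]
    constructor <;> linarith [h1.1, h1.2, h2.1, h2.2]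
  · have h1 := (hy.2 k).2 i
    have h2 := (hz.2 k).2 i
    have h := S.stateSeq_linear (1 / 2) (1 / 2) x x y.1 z.1 (k + 1)
    have hx : (1 / 2 : ℝ) • x + (1 / 2 : ℝ) • x = x := by module
    rw [hx] at h
    simp only [h, mulVec_add, mulVec_smul, Pi.add_apply, Pi.smul_apply, smul_eq_mul]
    constructor <;> linarith [h1.1, h1.2, h2.1, h2.2]

/-- Strict convexity: the midpoint of two distinct minimizing input sequences would be feasible and
strictly cheaper. -/
theorem HessianAssumption.optimal_unique (h4 : S.HessianAssumption) {τ : ℝ} {x : Fin nx → ℝ}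
    {v : Fin nv → ℝ} {y z : Decision nu mx mu N} (hy : S.IsOptimal τ x v y)
    (hz : S.IsOptimal τ x v z) : y.1 = z.1 := by
  by_contra hne
  have h0 := h4 (y.1 - z.1, S.constr 0 (y.1 - z.1))
    (fun h => hne (sub_eq_zero.1 (congrArg Prod.fst h))) rfl
  have h1 := hy.2 _ (hy.1.midpoint hz.1)
  have h2 := hz.2 _ (hy.1.midpoint hz.1)
  simp only [cost_midpoint] at h0 h1 h2
  linarith

end MPCData

theorem wSq_mulVec {m n : Type*} [Fintype m] [Fintype n] (E : Matrix m m ℝ) (X : Matrix m n ℝ)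
    (z : n → ℝ) : wSq E (X *ᵥ z) = wSq (Xᵀ * E * X) z := by
  simp only [wSq, ← mulVec_mulVec]
  rw [dotProduct_mulVec z Xᵀ, vecMul_transpose]

namespace MPCData

variable {nx nu nv mx mu N : ℕ} {S : MPCData nx nu nv mx mu N}

/-! ### Equilibria and the terminal controller -/

theorem IsEquilibriumBasis.equilibrium (hG : S.IsEquilibriumBasis) (v : Fin nv → ℝ) :
    S.A *ᵥ S.xEq v + S.B *ᵥ S.uEq v = S.xEq v := by
  have h1 : (Matrix.fromRows S.Gx S.Gu) *ᵥ v ∈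
      LinearMap.ker (Matrix.fromCols (S.A - 1) S.B).mulVecLin := by
    rw [← hG.2, ← Matrix.range_mulVecLin]
    exact ⟨v, rfl⟩
  rw [LinearMap.mem_ker, mulVecLin_apply, fromRows_mulVec, fromCols_mulVec] at h1
  simp only [sub_mulVec, one_mulVec, Sum.elim_comp_inl, Sum.elim_comp_inr] at h1
  rw [sub_add_eq_add_sub, sub_eq_zero] at h1
  exact h1

/-- The Riccati equation in closed-loop Lyapunov form. The two forms differ by `Kᵀ ((R + Bᵀ P B) K -
Bᵀ P A)`, which vanishes by the choice of the gain; `R ≻ 0` makes the inverse in the gain genuine.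
-/
theorem WeightAssumption.riccati (h3 : S.WeightAssumption) :
    (S.A - S.B * S.gain)ᵀ * S.P * (S.A - S.B * S.gain) + S.Q + S.gainᵀ * S.R * S.gain = S.P := by
  obtain ⟨hP, hQ, hR, hric⟩ := h3
  have hM : (S.R + S.Bᵀ * S.P * S.B).PosDef := by
    have := hP.posSemidef.conjTranspose_mul_mul_same S.B
    rw [conjTranspose_eq_transpose_of_trivial] at this
    exact hR.add_posSemidef this
  have hK : (S.R + S.Bᵀ * S.P * S.B) * S.gain = S.Bᵀ * S.P * S.A := by
    rw [gain, mul_nonsing_inv_cancel_left _ _ ((isUnit_iff_isUnit_det _).1 hM.isUnit)]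
  generalize S.gain = K at *
  have e : (S.A - S.B * K)ᵀ * S.P * (S.A - S.B * K) + S.Q + Kᵀ * S.R * K =
      S.Q + S.Aᵀ * S.P * S.A - (S.Aᵀ * S.P * S.B) * K
        + Kᵀ * ((S.R + S.Bᵀ * S.P * S.B) * K - S.Bᵀ * S.P * S.A) := by
    simp only [transpose_sub, transpose_mul, Matrix.mul_sub, Matrix.sub_mul, Matrix.mul_add,
      Matrix.add_mul, Matrix.mul_assoc]
    abel
  rw [e, hK, sub_self, Matrix.mul_zero, add_zero, ← hric]

theorem IsEquilibriumBasis.feedback_step (hG : S.IsEquilibriumBasis) (v : Fin nv → ℝ)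
    (x : Fin nx → ℝ) :
    S.A *ᵥ x + S.B *ᵥ S.feedback v x - S.xEq v = (S.A - S.B * S.gain) *ᵥ (x - S.xEq v) := by
  conv_lhs => rw [← hG.equilibrium v]
  simp only [feedback, mulVec_add, mulVec_neg, sub_mulVec, mulVec_sub, mulVec_mulVec]
  abel

/-- The Lyapunov form evaluated at `x - x_v`: one feedback step pays its stage cost exactly out of
the terminal cost. -/
theorem WeightAssumption.terminal_descent (h3 : S.WeightAssumption) (hG : S.IsEquilibriumBasis)
    (v : Fin nv → ℝ) (x : Fin nx → ℝ) :
    wSq S.P (S.A *ᵥ x + S.B *ᵥ S.feedback v x - S.xEq v) + S.stage v x (S.feedback v x) =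
      wSq S.P (x - S.xEq v) := by
  have hu : S.feedback v x - S.uEq v = -(S.gain *ᵥ (x - S.xEq v)) := by simp [feedback]
  rw [stage, hu, wSq_neg, hG.feedback_step, wSq_mulVec, wSq_mulVec]
  conv_rhs => rw [← h3.riccati]
  simp only [wSq, add_mulVec, dotProduct_add]
  ring

theorem WeightAssumption.feedback_mem_Omega (h3 : S.WeightAssumption)
    (hG : S.IsEquilibriumBasis) {p : ℝ} {v : Fin nv → ℝ} {x : Fin nx → ℝ}
    (hx : x ∈ S.Omega p v) : S.A *ᵥ x + S.B *ᵥ S.feedback v x ∈ S.Omega p v := by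
  have h1 := h3.terminal_descent hG v x
  have h2 := h3.stage_nonneg v x (S.feedback v x)
  have h4 : wSq S.P (x - S.xEq v) ≤ p := hx
  change wSq S.P _ ≤ p
  linarith

/-- Below the cost level `d p`, an optimal sequence ends in the terminal region. -/
theorem WeightAssumption.terminal_mem_Omega [NeZero nx] (h3 : S.WeightAssumption)
    (hG : S.IsEquilibriumBasis) {p : ℝ} {v : Fin nv → ℝ} (hΩ : S.Omega p v ⊆ S.feedbackSet 0 v)
    {x : Fin nx → ℝ} {y : Decision nu mx mu N} (hy : S.IsOptimal 0 x v y)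
    (hc : S.cost x v y.1 ≤ S.dConst * p) : S.stateSeq x y.1 N ∈ S.Omega p v := by
  obtain ⟨X, U, hT, hX0, hU, -, hX⟩ := S.exists_trajectory_feedback v x y.1 le_rfl
  have hη : y.1 = fun k : Fin N => U k := funext fun k => (hU k k.2).symm
  have hcost : S.cost x v y.1 =
      wSq S.P (X N - S.xEq v) + ∑ k ∈ Finset.range N, S.stage v (X k) (U k) := by
    rw [← hT.cost_eq, hX0, ← hη]
  rw [← hX N le_rfl]
  -- If the region is entered at some `i < N`, switching to the feedback there leaves a remaining
  -- cost of `‖X i - x_v‖_P² ≤ p`, and by optimality the remaining cost of the minimizer, hence its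
  -- terminal cost, is no larger. If it is never entered before `N`, the stage costs are too large
  -- for the level `d p`.
  by_cases h : ∃ i < N, X i ∈ S.Omega p v
  · obtain ⟨i, hi, hiΩ⟩ := h
    obtain ⟨X', U', hT', hX0', hU', hfb, hX'⟩ := S.exists_trajectory_feedback v x y.1 hi.le
    have hXi : X' i = X i := by rw [hX' i le_rfl, hX i hi.le]
    have hmem : ∀ k, i ≤ k → X' k ∈ S.Omega p v := by
      intro k hk
      induction k, hk using Nat.le_induction with
      | base => rwa [hXi]
      | succ k hk ih => rw [hT' k, hfb k hk]; exact h3.feedback_mem_Omega hG ih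
    have htel : ∀ m, i ≤ m → wSq S.P (X' m - S.xEq v) +
        ∑ k ∈ Finset.Ico i m, S.stage v (X' k) (U' k) = wSq S.P (X i - S.xEq v) := by
      intro m hm
      induction m, hm using Nat.le_induction with
      | base => simp [hXi]
      | succ k hk ih =>
        have := h3.terminal_descent hG v (X' k)
        rw [Finset.sum_Ico_succ_top hk, hT' k, hfb k hk]
        linarith
    -- Before the switch the constraints are inherited from the minimizer, including those on `X' i`
    -- itself; afterwards they hold because the feedback keeps the state in `Omega`.
    have hfeas := hT'.isFeasible (τ := 0) (fun k hk => by
      rcases lt_or_ge k i with hki | hki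
      · have := ((S.isFeasible_iff).1 hy.1).2 ⟨k, hk⟩
        rw [hU' ⟨k, hk⟩ hki, hX' (k + 1) hki]
        exact this
      · rw [hfb k hki]
        exact ⟨(hΩ (hmem k hki)).1, (hΩ (hmem (k + 1) (by omega))).2⟩)
    rw [hX0'] at hfeas
    have hle := hy.2 _ hfeas
    have hcost' := hT'.cost_eq v
    rw [hX0'] at hcost'
    simp only [hcost'] at hle
    rw [hcost, ← Finset.sum_range_add_sum_Ico _ hi.le, ← Finset.sum_range_add_sum_Ico _ hi.le]
      at hle
    have hsame : ∑ k ∈ Finset.range i, S.stage v (X' k) (U' k) =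
        ∑ k ∈ Finset.range i, S.stage v (X k) (U k) := by
      refine Finset.sum_congr rfl fun k hk => ?_
      have hk := Finset.mem_range.1 hk
      rw [hX' k hk.le, hX k (hk.trans hi).le, hU' ⟨k, hk.trans hi⟩ hk, hU ⟨k, hk.trans hi⟩ (hk.trans hi)]
    have htail : 0 ≤ ∑ k ∈ Finset.Ico i N, S.stage v (X k) (U k) :=
      Finset.sum_nonneg fun _ _ => h3.stage_nonneg _ _ _
    have hN := htel N hi.le
    have hiΩ' : wSq S.P (X i - S.xEq v) ≤ p := hiΩ
    change wSq S.P _ ≤ p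
    linarith
  · push Not at h
    by_contra hN
    have hN' : p < wSq S.P (X N - S.xEq v) := not_le.1 hN
    -- Outside `Omega` one has `‖x - x_v‖² > p / λ_max(P)`. The `N` stage costs supply the first
    -- term of `d p`, and the terminal cost, if it exceeded `p`, would supply the `+ 1` with strict
    -- inequality.
    have hstage : ∀ k ∈ Finset.range N, lamMin S.Q / lamMax S.P * p ≤ S.stage v (X k) (U k) := by
      intro k hk
      have h1 : p < wSq S.P (X k - S.xEq v) := not_le.1 (h k (Finset.mem_range.1 hk))
      have h2 := h3.1.isHermitian.wSq_le_lamMax_mul (X k - S.xEq v)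
      have h4 := h3.2.1.isHermitian.lamMin_mul_le_wSq (X k - S.xEq v)
      have h5 := h3.2.2.1.wSq_nonneg (U k - S.uEq v)
      have hl := h3.2.1.lamMin_pos
      have hL := h3.1.lamMax_pos
      have h6 : lamMin S.Q / lamMax S.P * p ≤ lamMin S.Q * eNorm (X k - S.xEq v) ^ 2 := by
        rw [div_mul_eq_mul_div, div_le_iff₀ hL, mul_assoc]
        exact mul_le_mul_of_nonneg_left (by linarith) hl.le
      rw [stage]
      linarith
    have hsum := Finset.card_nsmul_le_sum _ _ _ hstage
    rw [Finset.card_range, nsmul_eq_mul] at hsum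
    have : S.dConst * p = N * (lamMin S.Q / lamMax S.P * p) + p := by
      rw [dConst]; ring
    linarith

/-! ### Decrease of the optimal value under the exact controller -/

/-- Shifting an optimal sequence and appending the terminal feedback gives a feasible sequence
whose cost is lower by the first stage cost. -/
theorem WeightAssumption.value_succ_le [NeZero nx] [NeZero N] (h3 : S.WeightAssumption)
    (hG : S.IsEquilibriumBasis) {p : ℝ} {v : Fin nv → ℝ} (hΩ : S.Omega p v ⊆ S.feedbackSet 0 v)
    {x : Fin nx → ℝ} {y : Decision nu mx mu N} (hy : S.IsOptimal 0 x v y)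
    (hc : S.cost x v y.1 ≤ S.dConst * p) :
    S.A *ᵥ x + S.B *ᵥ y.1 0 ∈ S.feasStates 0 ∧
      S.value 0 (S.A *ᵥ x + S.B *ᵥ y.1 0) v ≤
        S.value 0 x v - lamMin S.Q * eNorm (x - S.xEq v) ^ 2 := by
  have hterm := h3.terminal_mem_Omega hG hΩ hy hc
  obtain ⟨X, U, hT, hX0, hU, hfb, hX⟩ := S.exists_trajectory_feedback v x y.1 le_rfl
  have hη : y.1 = fun k : Fin N => U k := funext fun k => (hU k k.2).symm
  have hcost : S.cost x v y.1 =
      wSq S.P (X N - S.xEq v) + ∑ k ∈ Finset.range N, S.stage v (X k) (U k) := by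
    rw [← hT.cost_eq, hX0, ← hη]
  rw [← hX N le_rfl] at hterm
  have hX1 : S.A *ᵥ x + S.B *ᵥ y.1 0 = X (0 + 1) := by
    have := hU 0 (Nat.pos_of_ne_zero (NeZero.ne N))
    simp only [Fin.val_zero] at this
    rw [hT 0, hX0, this]
  have hT1 : S.IsTrajectory (fun k => X (k + 1)) (fun k => U (k + 1)) := fun k => hT (k + 1)
  have hfeas := hT1.isFeasible (τ := 0) (fun k hk => by
    have hXk : ∀ j, j < N → U j ∈ S.inputSet 0 ∧ X (j + 1) ∈ S.stateSet 0 := by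
      intro j hj
      have := ((S.isFeasible_iff).1 hy.1).2 ⟨j, hj⟩
      rw [hX (j + 1) hj, hU ⟨j, hj⟩ hj]
      exact this
    rcases lt_or_ge (k + 1) N with hk' | hk'
    · exact hXk (k + 1) hk'
    · obtain rfl : k + 1 = N := by omega
      rw [hT (k + 1), hfb (k + 1) le_rfl]
      exact ⟨(hΩ hterm).1, (hΩ (h3.feedback_mem_Omega hG hterm)).2⟩)
  rw [hX1]
  refine ⟨⟨_, hfeas⟩, (h3.value_le v hfeas).trans ?_⟩
  have hs0 : lamMin S.Q * eNorm (x - S.xEq v) ^ 2 ≤ S.stage v (X 0) (U 0) := by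
    have h4 := h3.2.1.isHermitian.lamMin_mul_le_wSq (x - S.xEq v)
    have h5 := h3.2.2.1.wSq_nonneg (U 0 - S.uEq v)
    rw [stage, hX0]
    linarith
  -- The stage cost of the appended step cancels against the drop of the terminal cost, so that only
  -- the removed first stage cost remains.
  have hd := h3.terminal_descent hG v (X N)
  rw [← hfb N le_rfl, ← hT N] at hd
  have hcost1 := hT1.cost_eq v
  have hsum := Finset.sum_range_succ' (fun k => S.stage v (X k) (U k)) N
  rw [Finset.sum_range_succ] at hsum
  rw [hy.value_eq, hcost]
  simp only [hcost1]
  linarith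

/-- Resting at the equilibrium is feasible and costs nothing. This anchors the Lipschitz bound on
`ψ` at `x_v`. -/
theorem WeightAssumption.psi_equilibrium (h3 : S.WeightAssumption) (hG : S.IsEquilibriumBasis)
    {v : Fin nv → ℝ} (hx : S.xEq v ∈ S.stateSet 0) (hu : S.uEq v ∈ S.inputSet 0) :
    S.xEq v ∈ S.feasStates 0 ∧ S.psi 0 (S.xEq v) v = 0 := by
  have hT : S.IsTrajectory (fun _ => S.xEq v) (fun _ => S.uEq v) :=
    fun _ => (hG.equilibrium v).symm
  have hfeas := hT.isFeasible (τ := 0) (fun _ _ => ⟨hu, hx⟩)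
  refine ⟨⟨_, hfeas⟩, ?_⟩
  have h1 := h3.value_le v hfeas
  simp only [hT.cost_eq v] at h1
  refine Real.sqrt_eq_zero_of_nonpos (h1.trans_eq ?_)
  simp [stage, wSq_zero]

/-- Contraction of `ψ` under the exact controller. -/
theorem WeightAssumption.psi_succ_le [NeZero nx] [NeZero N] (h3 : S.WeightAssumption)
    (hG : S.IsEquilibriumBasis) {β : ℝ} (hβ1 : 1 < β) (hβ : S.IsValueLipschitz β)
    {p : ℝ} {v : Fin nv → ℝ} (hv : v ∈ S.refs)
    (hxv : S.xEq v ∈ S.stateSet 0) (huv : S.uEq v ∈ S.inputSet 0)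
    (hΩ : S.Omega p v ⊆ S.feedbackSet 0 v)
    {x : Fin nx → ℝ} {y : Decision nu mx mu N} (hy : S.IsOptimal 0 x v y)
    (hc : S.cost x v y.1 ≤ S.dConst * p) :
    S.psi 0 (S.A *ᵥ x + S.B *ᵥ y.1 0) v ≤ (1 - S.alpha1 β) * S.psi 0 x v := by
  obtain ⟨hfe, hψe⟩ := h3.psi_equilibrium hG hxv huv
  have hV := h3.value_nonneg 0 x v
  have hl := h3.2.1.lamMin_pos
  have h1 := hβ 0 le_rfl x ⟨y, hy.1⟩ _ hfe v hv v hv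
  rw [hψe, sub_zero, eNorm_sumElim_sub] at h1
  replace h1 := (le_abs_self _).trans h1
  have h2 : S.value 0 x v ≤ β ^ 2 * eNorm (x - S.xEq v) ^ 2 := by
    rw [← mul_pow]
    exact (Real.sqrt_le_left (mul_nonneg (by linarith) (eNorm_nonneg _))).1 h1
  have h5 : lamMin S.Q / β ^ 2 * S.value 0 x v ≤ lamMin S.Q * eNorm (x - S.xEq v) ^ 2 := by
    rw [div_mul_eq_mul_div, div_le_iff₀ (by positivity), mul_assoc, mul_comm (eNorm _ ^ 2)]
    exact mul_le_mul_of_nonneg_left h2 hl.le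
  have h6 := (h3.value_succ_le hG hΩ hy hc).2
  -- Only the value has to be nonnegative here: the square root of a negative number is `0`, so
  -- `λ_min(Q) ≤ β²` need not be checked.
  rw [alpha1, sub_sub_cancel, psi, psi, ← Real.sqrt_mul' _ hV]
  exact Real.sqrt_le_sqrt (by linarith)

/-! ### The weight of the stacked sequence -/

theorem wSq_Hchi (a : (Fin nx × Fin N) ⊕ (Fin nx ⊕ (Fin nu × Fin N)) → ℝ) :
    wSq S.Hchi a = ∑ k : Fin N, wSq S.Q (fun i => a (Sum.inl (i, k))) +
      (wSq S.P (fun i => a (Sum.inr (Sum.inl i))) +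
        ∑ k : Fin N, wSq S.R (fun i => a (Sum.inr (Sum.inr (i, k))))) := by
  rw [Hchi, wSq_fromBlocks_diagonal, wSq_fromBlocks_diagonal, wSq_blockDiagonal,
    wSq_blockDiagonal]
  rfl

theorem WeightAssumption.Hchi_posDef (h3 : S.WeightAssumption) : S.Hchi.PosDef := by
  have hH : S.Hchi.IsHermitian := by
    have hP : S.Pᵀ = S.P := h3.1.isHermitian
    have hQ : S.Qᵀ = S.Q := h3.2.1.isHermitian
    have hR : S.Rᵀ = S.R := h3.2.2.1.isHermitian
    simp [IsHermitian, Hchi, fromBlocks_transpose, blockDiagonal_transpose, hP, hQ, hR]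
  refine posDef_of_wSq_pos hH fun a ha => ?_
  have hQ := fun k : Fin N => h3.2.1.wSq_nonneg fun i => a (Sum.inl (i, k))
  have hP := h3.1.wSq_nonneg fun i => a (Sum.inr (Sum.inl i))
  have hR := fun k : Fin N => h3.2.2.1.wSq_nonneg fun i => a (Sum.inr (Sum.inr (i, k)))
  have hQs := Finset.sum_nonneg fun k (_ : k ∈ Finset.univ) => hQ k
  have hRs := Finset.sum_nonneg fun k (_ : k ∈ Finset.univ) => hR k
  rw [wSq_Hchi]
  obtain ⟨j, hj⟩ := Function.ne_iff.1 ha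
  rcases j with ⟨i, k⟩ | i | ⟨i, k⟩
  · have h1 := h3.2.1.wSq_pos (a := fun i => a (Sum.inl (i, k))) (Function.ne_iff.2 ⟨i, hj⟩)
    have h2 := Finset.single_le_sum (fun k _ => hQ k) (Finset.mem_univ k)
    linarith
  · have h1 := h3.1.wSq_pos (a := fun i => a (Sum.inr (Sum.inl i))) (Function.ne_iff.2 ⟨i, hj⟩)
    linarith
  · have h1 := h3.2.2.1.wSq_pos (a := fun i => a (Sum.inr (Sum.inr (i, k))))
      (Function.ne_iff.2 ⟨i, hj⟩)
    have h2 := Finset.single_le_sum (fun k _ => hR k) (Finset.mem_univ k)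
    linarith

theorem WeightAssumption.lamMin_Hchi_pos [NeZero nx] (h3 : S.WeightAssumption) :
    0 < lamMin S.Hchi :=
  h3.Hchi_posDef.lamMin_pos

/-- The cost controls the initial deviations of the state and the input. -/
theorem WeightAssumption.lamMin_Hchi_mul_le_cost [NeZero nx] [NeZero N] (h3 : S.WeightAssumption)
    (x : Fin nx → ℝ) (v : Fin nv → ℝ) (η : Fin N → Fin nu → ℝ) :
    lamMin S.Hchi * eNorm (x - S.xEq v) ^ 2 ≤ S.cost x v η ∧
      lamMin S.Hchi * eNorm (η 0 - S.uEq v) ^ 2 ≤ S.cost x v η := by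
  -- The stacked deviations of all states and inputs, for which `Hchi` gives exactly the cost. Each
  -- claim then keeps a single block of `‖a‖²`.
  let a : (Fin nx × Fin N) ⊕ (Fin nx ⊕ (Fin nu × Fin N)) → ℝ :=
    Sum.elim (fun i => (S.stateSeq x η i.2 - S.xEq v) i.1)
      (Sum.elim (S.stateSeq x η N - S.xEq v) fun i => (η i.2 - S.uEq v) i.1)
  have h1 : wSq S.Hchi a = S.cost x v η := by
    rw [wSq_Hchi, cost, Finset.sum_add_distrib]
    simp only [a, Sum.elim_inl, Sum.elim_inr]
    ring
  have h2 := h3.Hchi_posDef.isHermitian.lamMin_mul_le_wSq a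
  rw [h1] at h2
  have hsq : eNorm a ^ 2 = ∑ k : Fin N, eNorm (S.stateSeq x η k - S.xEq v) ^ 2 +
      (eNorm (S.stateSeq x η N - S.xEq v) ^ 2 + ∑ k : Fin N, eNorm (η k - S.uEq v) ^ 2) := by
    simp only [eNorm_sq, dotProduct, Fintype.sum_sum_type, Fintype.sum_prod_type_right, a,
      Sum.elim_inl, Sum.elim_inr]
  have hsx := fun k : Fin N => sq_nonneg (eNorm (S.stateSeq x η k - S.xEq v))
  have hsu := fun k : Fin N => sq_nonneg (eNorm (η k - S.uEq v))
  have hx := Finset.single_le_sum (fun k _ => hsx k) (Finset.mem_univ 0)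
  have hu := Finset.single_le_sum (fun k _ => hsu k) (Finset.mem_univ 0)
  have hx0 : S.stateSeq x η ((0 : Fin N) : ℕ) = x := by rw [Fin.val_zero]; rfl
  rw [hx0] at hx
  have hxs := Finset.sum_nonneg fun k (_ : k ∈ Finset.univ) => hsx k
  have hus := Finset.sum_nonneg fun k (_ : k ∈ Finset.univ) => hsu k
  have hP := sq_nonneg (eNorm (S.stateSeq x η N - S.xEq v))
  have hl := h3.lamMin_Hchi_pos.le
  rw [hsq] at h2
  exact ⟨(mul_le_mul_of_nonneg_left (by linarith) hl).trans h2,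
    (mul_le_mul_of_nonneg_left (by linarith) hl).trans h2⟩

/-- The nominal displacement of the plant in one step is bounded by `ψ`. -/
theorem WeightAssumption.eNorm_displacement_le [NeZero nx] [NeZero N] (h3 : S.WeightAssumption)
    (hG : S.IsEquilibriumBasis) {τ : ℝ} {x : Fin nx → ℝ} {v : Fin nv → ℝ}
    {y : Decision nu mx mu N} (hy : S.IsOptimal τ x v y) :
    eNorm (S.A *ᵥ x + S.B *ᵥ y.1 0 - x) ≤
      (sigmaMax (S.A - 1) + sigmaMax S.B) / Real.sqrt (lamMin S.Hchi) * S.psi τ x v := by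
  have hl := h3.lamMin_Hchi_pos
  have key : ∀ r : ℝ, 0 ≤ r → lamMin S.Hchi * r ^ 2 ≤ S.cost x v y.1 →
      r ≤ S.psi τ x v / Real.sqrt (lamMin S.Hchi) := by
    intro r hr h
    rw [le_div_iff₀ (Real.sqrt_pos.2 hl), psi, hy.value_eq]
    refine Real.le_sqrt_of_sq_le ?_
    rw [mul_pow, Real.sq_sqrt hl.le, mul_comm]
    exact h
  obtain ⟨hx, hu⟩ := h3.lamMin_Hchi_mul_le_cost x v y.1
  have hx' := key _ (eNorm_nonneg _) hx
  have hu' := key _ (eNorm_nonneg _) hu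
  -- At the equilibrium `(A - I) x_v + B u_v = 0`, so the displacement depends on the deviations
  -- only.
  have e : S.A *ᵥ x + S.B *ᵥ y.1 0 - x =
      (S.A - 1) *ᵥ (x - S.xEq v) + S.B *ᵥ (y.1 0 - S.uEq v) := by
    have := hG.equilibrium v
    rw [← eq_sub_iff_add_eq'] at this
    simp only [sub_mulVec, mulVec_sub, one_mulVec, this]
    abel
  rw [e]
  calc _ ≤ _ := eNorm_add_le _ _
    _ ≤ sigmaMax (S.A - 1) * (S.psi τ x v / Real.sqrt (lamMin S.Hchi)) +
        sigmaMax S.B * (S.psi τ x v / Real.sqrt (lamMin S.Hchi)) :=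
      add_le_add
        ((eNorm_mulVec_le _ _).trans (mul_le_mul_of_nonneg_left hx' (sigmaMax_nonneg _)))
        ((eNorm_mulVec_le _ _).trans (mul_le_mul_of_nonneg_left hu' (sigmaMax_nonneg _)))
    _ = _ := by ring

end MPCData

/-! ### The inexact controller -/

namespace MPCData

variable {nx nu nv mx mu N : ℕ} {S : MPCData nx nu nv mx mu N}

/-- A perturbation of a feasible state within a region whose states are robustly feasible is
feasible. -/
theorem mem_GamCheck_of_close {β : ℝ} (hβ0 : 0 ≤ β) (hβ : S.IsValueLipschitz β)
    {v : Fin nv → ℝ} (hv : v ∈ S.refs) {ψc τc : ℝ} (hτc : 0 < τc)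
    (hΓ : S.GamCheck ψc v ⊆ S.feasStates τc) {a b : Fin nx → ℝ} (ha : a ∈ S.feasStates 0)
    (hab : S.psi 0 a v + β * eNorm (b - a) ≤ ψc) : b ∈ S.GamCheck ψc v := by
  -- The Lipschitz bound presupposes feasibility, so it is stated for all feasible points as close
  -- to `a` as `b` is, and applied along the segment before it is applied to `b`.
  have hψ : ∀ x ∈ S.feasStates 0, eNorm (x - a) ≤ eNorm (b - a) → S.psi 0 x v ≤ ψc := by
    intro x hx hxa
    have h1 := (le_abs_self _).trans (hβ 0 le_rfl x hx a ha v hv v hv)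
    rw [eNorm_sumElim_sub] at h1
    linarith [mul_le_mul_of_nonneg_left hxa hβ0]
  obtain ⟨δ, hδ, hthick⟩ := S.exists_thickening_feasStates hτc
  have hb : b ∈ S.feasStates 0 := mem_of_uniform_thickening hδ ha fun x hx hxa y hy =>
    hthick x (hΓ ⟨hx, hψ x hx hxa⟩) y hy
  exact ⟨hb, hψ b hb le_rfl⟩

end MPCData

/-! ### One closed-loop step with the inexact optimizer -/

section Loop

variable {nx nu nv mx mu N : ℕ} {S : MPCData nx nu nv mx mu N} [NeZero N]
  {W : Type*} [TopologicalSpace W] {O : Optimizer nx nu nv mx mu N W}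

/-- Existence of a minimizer comes from the optimizer's limit state, which is assumed to yield one;
no compactness argument is needed. -/
theorem Optimizer.IsAdmissible.isOptimal_epsilon (hO : O.IsAdmissible S) {τ : ℝ} (hτ : 0 ≤ τ)
    {x : Fin nx → ℝ} (hx : x ∈ S.feasStates τ) {v : Fin nv → ℝ} (hv : v ∈ S.refs) (w : W) :
    S.IsOptimal τ x v (Classical.epsilon fun y => S.IsOptimal τ x v y) :=
  Classical.epsilon_spec ⟨_, (hO τ hτ x hx v hv w).1.1⟩

/-- The first control read off from the returned optimizer state is within `τ` of the exact one. -/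
theorem Optimizer.IsAdmissible.eNorm_out_final_le (hO : O.IsAdmissible S)
    (h4 : S.HessianAssumption) {τ : ℝ} (hτ : 0 ≤ τ) {x : Fin nx → ℝ} (hx : x ∈ S.feasStates τ)
    {v : Fin nv → ℝ} (hv : v ∈ S.refs) (w : W) :
    eNorm ((O.out τ x v (O.final τ x v w)).1 0 - S.uStar τ x v) ≤ τ := by
  obtain ⟨⟨hopt, -⟩, -, hDr⟩ := hO τ hτ x hx v hv w
  unfold Optimizer.final
  split_ifs with h
  · classical
    exact (pow_le_pow_iff_left₀ (eNorm_nonneg _) hτ two_ne_zero).1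
      ((hDr _).trans (Nat.find_spec h).1)
  -- `uStar` picks some minimizer and the limit state yields another; uniqueness makes their first
  -- controls equal.
  · rw [MPCData.uStar, h4.optimal_unique hopt (hO.isOptimal_epsilon hτ hx hv w), sub_self,
      eNorm_zero]
    exact hτ

/-- The distance of the returned control to the exact control of the untightened problem. -/
theorem Optimizer.IsAdmissible.eNorm_out_final_sub_uStar_zero_le (hO : O.IsAdmissible S)
    (h4 : S.HessianAssumption) {φ : ℝ} (hφ : S.IsInputLipschitz φ) {τ : ℝ} (hτ : 0 ≤ τ)
    {x : Fin nx → ℝ} (hx : x ∈ S.feasStates τ) {v : Fin nv → ℝ} (hv : v ∈ S.refs) (w : W) :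
    eNorm ((O.out τ x v (O.final τ x v w)).1 0 - S.uStar 0 x v) ≤ (φ + 1) * τ := by
  have h1 := hO.eNorm_out_final_le h4 hτ hx hv w
  have h2 := hφ τ 0 hτ le_rfl x hx (S.feasStates_anti hτ hx) v hv
  rw [sub_zero, abs_of_nonneg hτ] at h2
  rw [← sub_add_sub_cancel _ (S.uStar τ x v)]
  linarith [eNorm_add_le ((O.out τ x v (O.final τ x v w)).1 0 - S.uStar τ x v)
    (S.uStar τ x v - S.uStar 0 x v)]

/-- One step of the closed loop maps the region into itself. -/
theorem loopStep_mem [NeZero nx] (hG : S.IsEquilibriumBasis) (h1 : S.ConstraintAssumption)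
    (h3 : S.WeightAssumption) (h4 : S.HessianAssumption) (hO : O.IsAdmissible S)
    {β φ : ℝ} (hβ1 : 1 < β) (hφ0 : 0 ≤ φ) (hβ : S.IsValueLipschitz β) (hφ : S.IsInputLipschitz φ)
    {π1 π2 : ℝ} (hπ1 : 0 < π1) (hπ2 : 0 < π2) (hα2 : 0 < S.alpha2 φ π1 π2)
    {v : Fin nv → ℝ} (hv : v ∈ S.refs) {p ψc τc : ℝ} (hp : 0 < p)
    (hΩ : S.Omega p v ⊆ S.feedbackSet τc v) (hψc : ψc ≤ Real.sqrt (S.dConst * p))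
    (hΓ : S.GamCheck ψc v ⊆ S.Gam τc p v)
    (hlo : S.zeta2 π2 / S.alpha2 φ π1 π2 * ψc ≤ τc)
    (hhi : τc ≤ S.alpha1 β / S.zeta1 β φ * ψc)
    {s : LoopState nx W} (hs : (s.x, s.τ) ∈ S.GamCheck ψc v ×ˢ DelCheck τc) :
    ((loopStep S O π1 π2 v s).x, (loopStep S O π1 π2 v s).τ) ∈
      S.GamCheck ψc v ×ˢ DelCheck τc := by
  obtain ⟨x, τ, w⟩ := s
  obtain ⟨hx, hτ0, hττ⟩ : x ∈ S.GamCheck ψc v ∧ 0 ≤ τ ∧ τ ≤ τc := hs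
  have hτc : 0 ≤ τc := hτ0.trans hττ
  have hxτ : x ∈ S.feasStates τ := S.feasStates_anti hττ (hΓ hx).1
  obtain ⟨hxv, huv⟩ := interior_subset (h1.2.2 v hv)
  have hΩ0 : S.Omega p v ⊆ S.feedbackSet 0 v := fun z hz =>
    ⟨S.inputSet_anti hτc (hΩ hz).1, S.stateSet_anti hτc (hΩ hz).2⟩
  have hd : 0 ≤ S.dConst * p := by
    have := h3.2.1.lamMin_pos
    have := h3.1.lamMax_pos
    rw [MPCData.dConst]
    positivity
  have hψ0 : 0 ≤ S.psi 0 x v := Real.sqrt_nonneg _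
  have hψc0 : 0 ≤ ψc := hψ0.trans hx.2
  have hopt := hO.isOptimal_epsilon le_rfl hx.1 hv w
  have hcost : S.cost x v (Classical.epsilon fun y => S.IsOptimal 0 x v y).1 ≤ S.dConst * p := by
    rw [← hopt.value_eq]
    exact (Real.sqrt_le_sqrt_iff hd).1 (hx.2.trans hψc)
  have hfeas := (h3.value_succ_le hG hΩ0 hopt hcost).1
  have hcontr := h3.psi_succ_le hG hβ1 hβ hv hxv huv hΩ0 hopt hcost
  have hdisp := h3.eNorm_displacement_le hG hopt
  change S.A *ᵥ x + S.B *ᵥ S.uStar 0 x v ∈ _ at hfeas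
  change S.psi 0 (S.A *ᵥ x + S.B *ᵥ S.uStar 0 x v) v ≤ _ at hcontr
  change eNorm (S.A *ᵥ x + S.B *ᵥ S.uStar 0 x v - x) ≤ _ at hdisp
  have hu := hO.eNorm_out_final_sub_uStar_zero_le h4 hφ hτ0 hxτ hv w
  have hB := sigmaMax_nonneg S.B
  have hα1 : 0 ≤ S.alpha1 β := by
    rw [MPCData.alpha1, sub_nonneg, Real.sqrt_le_one]
    have := h3.2.1.lamMin_pos
    linarith [div_nonneg this.le (sq_nonneg β)]
  have hα1' : 0 ≤ 1 - S.alpha1 β := by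
    rw [MPCData.alpha1, sub_sub_cancel]
    exact Real.sqrt_nonneg _
  have hζ1 : 0 ≤ S.zeta1 β φ := by
    rw [MPCData.zeta1]
    positivity
  -- If `ζ₁ = 0` (for instance when `B = 0`), the quotient in the upper bound on `τc` is a division
  -- by zero, but the claim is then trivial.
  have hζτ : S.zeta1 β φ * τ ≤ S.alpha1 β * ψc := by
    rcases hζ1.eq_or_lt with h | h
    · rw [← h, zero_mul]
      exact mul_nonneg hα1 hψc0
    · rw [div_mul_eq_mul_div, le_div_iff₀ h] at hhi
      nlinarith
  change S.A *ᵥ x + S.B *ᵥ (O.out τ x v (O.final τ x v w)).1 0 ∈ S.GamCheck ψc v ∧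
    0 ≤ tightenUpdate π1 π2 (S.A *ᵥ x + S.B *ᵥ (O.out τ x v (O.final τ x v w)).1 0) x v v τ ∧
    tightenUpdate π1 π2 (S.A *ᵥ x + S.B *ᵥ (O.out τ x v (O.final τ x v w)).1 0) x v v τ ≤ τc
  generalize (O.out τ x v (O.final τ x v w)).1 0 = u at hu ⊢
  generalize S.uStar 0 x v = u₀ at *
  have hBu : eNorm (S.A *ᵥ x + S.B *ᵥ u - (S.A *ᵥ x + S.B *ᵥ u₀)) ≤
      sigmaMax S.B * ((φ + 1) * τ) := by
    rw [add_sub_add_left_eq_sub, ← mulVec_sub]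
    exact (eNorm_mulVec_le _ _).trans (mul_le_mul_of_nonneg_left hu hB)
  have hψx : (1 - S.alpha1 β) * S.psi 0 x v ≤ (1 - S.alpha1 β) * ψc :=
    mul_le_mul_of_nonneg_left hx.2 hα1'
  refine ⟨?_, ?_, ?_⟩
  -- For `τc = 0` there is no slack to walk with, but then `τ = 0` and the applied control is the
  -- exact one.
  · rcases hτc.eq_or_lt with h | h
    · have hτ : τ = 0 := by linarith
      rw [hτ, mul_zero] at hu
      rw [sub_eq_zero.1 (eNorm_eq_zero.1 (hu.antisymm (eNorm_nonneg _)))]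
      exact ⟨hfeas, by linarith [mul_nonneg hα1 hψc0]⟩
    · refine MPCData.mem_GamCheck_of_close (by linarith) hβ hv h (fun z hz => (hΓ hz).1) hfeas ?_
      have : β * eNorm (S.A *ᵥ x + S.B *ᵥ u - (S.A *ᵥ x + S.B *ᵥ u₀)) ≤ S.zeta1 β φ * τ := by
        refine (mul_le_mul_of_nonneg_left hBu (by linarith)).trans_eq ?_
        rw [MPCData.zeta1]
        ring
      linarith
  · exact add_nonneg (mul_nonneg hπ1.le hτ0) (mul_nonneg hπ2.le (eNorm_nonneg _))
  · rw [tightenUpdate, eNorm_sumElim_sub]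
    have htri : eNorm (S.A *ᵥ x + S.B *ᵥ u - x) ≤ sigmaMax S.B * ((φ + 1) * τ) +
        (sigmaMax (S.A - 1) + sigmaMax S.B) / Real.sqrt (lamMin S.Hchi) * S.psi 0 x v := by
      rw [← sub_add_sub_cancel _ (S.A *ᵥ x + S.B *ᵥ u₀)]
      exact (eNorm_add_le _ _).trans (add_le_add hBu hdisp)
    have hζ2 : S.zeta2 π2 * S.psi 0 x v ≤ S.alpha2 φ π1 π2 * τc := by
      rw [div_mul_eq_mul_div, div_le_iff₀ hα2] at hlo
      refine (mul_le_mul_of_nonneg_left hx.2 ?_).trans (hlo.trans_eq (mul_comm _ _))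
      have := sigmaMax_nonneg (S.A - 1)
      rw [MPCData.zeta2]
      positivity
    -- The coefficient is `1 - α₂`, so with the bound `α₂ τc` on the `ψ` term the total is exactly
    -- `τc`.
    have hτ' : (π1 + π2 * sigmaMax S.B * (φ + 1)) * τ ≤
        (π1 + π2 * sigmaMax S.B * (φ + 1)) * τc :=
      mul_le_mul_of_nonneg_left hττ (by positivity)
    have := mul_le_mul_of_nonneg_left htri hπ2.le
    rw [MPCData.zeta2, MPCData.alpha2] at hζ2
    linarith

end Loop

end

theorem lemma2 {nx nu nv mx mu N : ℕ} [NeZero nx] [NeZero nu] [NeZero N]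
    (S : MPCData nx nu nv mx mu N)
    (hG : S.IsEquilibriumBasis) (hS : S.IsStandard)
    (h1 : S.ConstraintAssumption) (h2 : IsStabilizable S.A S.B)
    (h3 : S.WeightAssumption) (h4 : S.HessianAssumption)
    {W : Type*} [TopologicalSpace W] (O : Optimizer nx nu nv mx mu N W) (hO : O.IsAdmissible S)
    (β φ : ℝ) (hβ1 : 1 < β) (hφ0 : 0 ≤ φ) (hβ : S.IsValueLipschitz β) (hφ : S.IsInputLipschitz φ)
    (π1 π2 : ℝ) (hπ1 : 0 < π1 ∧ π1 < 1) (hπ2 : 0 < π2 ∧ π2 < 1)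
    (hα2 : 0 < S.alpha2 φ π1 π2)
    (v : Fin nv → ℝ) (hv : v ∈ S.refs)
    (p ψc τc : ℝ) (hp : 0 < p)
    (hΩ : S.Omega p v ⊆ S.feedbackSet τc v)
    (hψc : ψc ≤ Real.sqrt (S.dConst * p))
    (hΓ : S.GamCheck ψc v ⊆ S.Gam τc p v)
    (hlo : S.zeta2 π2 / S.alpha2 φ π1 π2 * ψc ≤ τc)
    (hhi : τc ≤ S.alpha1 β / S.zeta1 β φ * ψc) :
    ∀ s : LoopState nx W, (s.x, s.τ) ∈ S.GamCheck ψc v ×ˢ DelCheck τc →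
      (∀ t, (loopTraj S O π1 π2 v s t).x ∈ S.feasStates (loopTraj S O π1 π2 v s t).τ) ∧
      (∀ t, ((loopTraj S O π1 π2 v s t).x, (loopTraj S O π1 π2 v s t).τ) ∈
        S.GamCheck ψc v ×ˢ DelCheck τc) := by
  intro s hs
  have hinv : ∀ t, ((loopTraj S O π1 π2 v s t).x, (loopTraj S O π1 π2 v s t).τ) ∈
      S.GamCheck ψc v ×ˢ DelCheck τc := by
    intro t
    induction t with
    | zero => exact hs
    | succ t ih =>
      rw [loopTraj, Function.iterate_succ_apply']
      exact loopStep_mem hG h1 h3 h4 hO hβ1 hφ0 hβ hφ hπ1.1 hπ2.1 hα2 hv hp hΩ hψc hΓ hlo hhi ih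
  -- Feasibility at `τc` is part of the inclusion of `GamCheck` in `Gam`, and `τ ≤ τc` only relaxes
  -- the constraints.
  exact ⟨fun t => S.feasStates_anti (hinv t).2.2 (hΓ (hinv t).1).1, hinv⟩
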